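/- Let $\mathbb K$ be an algebraically closed field of characteristic zero and let $n\ge 7$. An algebraic monoid structure on the affine space $\mathbb A^n$ is an associative multiplication $\mathbb A^n\times\mathbb A^n\to\mathbb A^n$ with unit which is a morphism of algebraic varieties. It is called bilinear if the multiplication is a bilinear map in some coordinates on $\mathbb A^n$, that is, after some automorphism of the variety $\mathbb A^n$. Two such structures are isomorphic if there is an automorphism of the variety $\mathbb A^n$ which is an isomorphism between the two monoids. Then there are pairwise non-isomorphic commutative monoid structures on $\mathbb A^n$ parameterized by a variety of positive dimension. More precisely, there exist an irreducible affine variety $M$ over $\mathbb K$ with $\dim M>0$ and a family $(S_t)_{t\in M}$ of algebraic monoid structures on $\mathbb A^n$, depending algebraically on $t$ (the multiplication $M\times\mathbb A^n\times\mathbb A^n\to\mathbb A^n$ and the unit $M\to\mathbb A^n$ are morphisms of varieties), such that: 1. for every $t\in M$ the monoid $S_t$ is commutative and bilinear, and it is isomorphic as an algebraic monoid to the multiplicative monoid of some $n$-dimensional commutative local associative $\mathbb K$-algebra with unit; 2. for all $s\ne t$ in $M$ the algebraic monoids $S_s$ and $S_t$ are not isomorphic. -/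

import Mathlib

universe u

namespace AffineMonoids

variable {K : Type u} [Field K]

/-- A morphism of affine spaces `𝔸^σ → 𝔸^τ` (identified with their sets of `K`-points, `K` being
an infinite field): every coordinate is given by a polynomial. -/
def IsRegular {σ τ : Type*} (f : (σ → K) → (τ → K)) : Prop :=
  ∃ p : τ → MvPolynomial σ K, ∀ x j, f x j = MvPolynomial.eval x (p j)

/-- A structure of an algebraic monoid on the affine space `𝔸^n`: an associative multiplication
with unit which is a morphism of varieties `𝔸^n × 𝔸^n → 𝔸^n`. -/
structure AlgMonoid (K : Type u) [Field K] (n : ℕ) where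
  /-- the multiplication -/
  mul : (Fin n → K) → (Fin n → K) → (Fin n → K)
  /-- the unit -/
  one : Fin n → K
  mul_assoc : ∀ x y z, mul (mul x y) z = mul x (mul y z)
  one_mul : ∀ x, mul one x = x
  mul_one : ∀ x, mul x one = x
  regular : IsRegular fun z : Fin n ⊕ Fin n → K => mul (z ∘ Sum.inl) (z ∘ Sum.inr)

/-- An automorphism of the variety `𝔸^n`: a bijection which is regular together with its
inverse. -/
def IsPolyAut {n : ℕ} (e : (Fin n → K) ≃ (Fin n → K)) : Prop :=
  IsRegular e ∧ IsRegular e.symm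

namespace AlgMonoid

variable {n : ℕ}

def IsCommutative (S : AlgMonoid K n) : Prop :=
  ∀ x y, S.mul x y = S.mul y x

/-- The monoid is bilinear: in suitable coordinates on `𝔸^n` (that is, after an automorphism of
the variety `𝔸^n`) the multiplication is a bilinear map. -/
def IsBilinear (S : AlgMonoid K n) : Prop :=
  ∃ e : (Fin n → K) ≃ (Fin n → K), IsPolyAut e ∧
    ∃ B : (Fin n → K) →ₗ[K] (Fin n → K) →ₗ[K] (Fin n → K),
      ∀ x y, e (S.mul x y) = B (e x) (e y)

/-- Isomorphism of algebraic monoids: an isomorphism of varieties which is an isomorphism of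
monoids. -/
def Isomorphic (S T : AlgMonoid K n) : Prop :=
  ∃ e : (Fin n → K) ≃ (Fin n → K), IsPolyAut e ∧ e S.one = T.one ∧
    ∀ x y, e (S.mul x y) = T.mul (e x) (e y)

/-- The multiplicative monoid of a finite-dimensional commutative associative algebra with unit
`A`, viewed as an algebraic monoid on `𝔸^n` through a basis of `A`. -/
noncomputable def ofAlgebra {A : Type u} [CommRing A] [Algebra K A]
    (b : Module.Basis (Fin n) K A) : AlgMonoid K n where
  mul x y := b.equivFun (b.equivFun.symm x * b.equivFun.symm y)
  one := b.equivFun 1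
  mul_assoc x y z := by simp only [LinearEquiv.symm_apply_apply, _root_.mul_assoc]
  one_mul x := by simp only [LinearEquiv.symm_apply_apply, _root_.one_mul,
    LinearEquiv.apply_symm_apply]
  mul_one x := by simp only [LinearEquiv.symm_apply_apply, _root_.mul_one,
    LinearEquiv.apply_symm_apply]
  regular := by
    refine ⟨fun k => ∑ i, ∑ j, MvPolynomial.C (b.equivFun (b i * b j) k) *
      (MvPolynomial.X (Sum.inl i) * MvPolynomial.X (Sum.inr j)), fun z k => ?_⟩
    simp only [Module.Basis.equivFun_symm_apply, Finset.sum_mul_sum, map_sum, Finset.sum_apply,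
      map_mul, MvPolynomial.eval_C, MvPolynomial.eval_X, smul_mul_smul_comm, map_smul,
      Pi.smul_apply, smul_eq_mul, Function.comp_apply]
    exact Finset.sum_congr rfl fun i _ => Finset.sum_congr rfl fun j _ => mul_comm _ _

/-- The monoid is isomorphic to the multiplicative monoid of a (commutative, `n`-dimensional)
local algebra. -/
def IsOfLocalAlgebra (S : AlgMonoid K n) : Prop :=
  ∃ (A : Type u) (_ : CommRing A) (_ : Algebra K A) (b : Module.Basis (Fin n) K A),
    IsLocalRing A ∧ S.Isomorphic (ofAlgebra b)

end AlgMonoid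

/-- An irreducible affine variety embedded in `𝔸^m`: the zero set of a prime ideal. -/
def IsAffineVariety {m : ℕ} (M : Set (Fin m → K)) : Prop :=
  ∃ I : Ideal (MvPolynomial (Fin m) K), I.IsPrime ∧ M = MvPolynomial.zeroLocus K I

/-- The dimension of a Zariski-closed set: the Krull dimension of its coordinate ring. -/
noncomputable def dimension {m : ℕ} (M : Set (Fin m → K)) : WithBot ℕ∞ :=
  ringKrullDim (MvPolynomial (Fin m) K ⧸ MvPolynomial.vanishingIdeal K M)

/-- A family of algebraic monoid structures on `𝔸^n` parameterized by a closed subset `M` of `𝔸^m`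
is algebraic if the multiplication `M × 𝔸^n × 𝔸^n → 𝔸^n` and the unit section `M → 𝔸^n` are
regular, i.e. are restrictions of polynomial maps. -/
def IsAlgebraicFamily {m n : ℕ} {M : Set (Fin m → K)} (S : M → AlgMonoid K n) : Prop :=
  (∃ p : Fin n → MvPolynomial (Fin m ⊕ (Fin n ⊕ Fin n)) K, ∀ (t : M) (x y : Fin n → K) (i : Fin n),
    (S t).mul x y i = MvPolynomial.eval (Sum.elim t.1 (Sum.elim x y)) (p i)) ∧
  (∃ q : Fin n → MvPolynomial (Fin m) K, ∀ (t : M) (i : Fin n),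
    (S t).one i = MvPolynomial.eval t.1 (q i))

end AffineMonoids

/-! The parameter space is the affine line. For a parameter `t`, take the local algebra `K ⊕ 𝔪` with
`𝔪³ = 0` whose product on `𝔪` is a pair of quadratic forms in four variables with values in a plane;
the remaining basis vectors annihilate `𝔪`. The discriminant of this pencil of quadrics is, up to
sign, the binary quartic `y (x³ + t x y² + t y³)`. A monoid isomorphism is a priori only polynomial,
but it intertwines unital bilinear products and is therefore linear
(`IsPolyAut.exists_linearEquiv`). It then preserves `𝔪` and the plane `𝔪²`, so it relates the two
discriminants by a linear substitution and a square factor (`eq_of_pencilMul_linearEquiv`). The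
invariants `I` and `J` of the quartic are `-3t` and `-27t`, so `I³/J² = -t/27` for `t ≠ 0` recovers
the parameter (`binaryQuartic_eq_of_equiv`). -/

namespace AffineMonoids

/-! ### Differential of a polynomial at the origin -/

section LinearPart

variable {K : Type*} [Field K] {σ τ : Type*}

/-- The restriction of a polynomial to the line through the origin spanned by `y`. -/
noncomputable def lineRestrict (p : MvPolynomial σ K) (y : σ → K) : Polynomial K :=
  MvPolynomial.aeval (fun i => Polynomial.C (y i) * Polynomial.X) p

theorem eval_aeval_polynomial (p : MvPolynomial σ K) (f : σ → Polynomial K) (c : K) :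
    (MvPolynomial.aeval f p).eval c = MvPolynomial.eval (fun i => (f i).eval c) p := by
  induction p using MvPolynomial.induction_on with
  | C a => simp
  | add p q hp hq => simp [hp, hq]
  | mul_X p i hp => simp [hp]

theorem eval_lineRestrict (p : MvPolynomial σ K) (y : σ → K) (c : K) :
    (lineRestrict p y).eval c = MvPolynomial.eval (c • y) p := by
  rw [lineRestrict, eval_aeval_polynomial]
  refine congrArg (fun z => MvPolynomial.eval z p) (funext fun i => ?_)
  simp only [Polynomial.eval_mul, Polynomial.eval_C, Polynomial.eval_X, Pi.smul_apply, smul_eq_mul]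
  exact mul_comm _ _

theorem coeff_zero_lineRestrict (p : MvPolynomial σ K) (y : σ → K) :
    (lineRestrict p y).coeff 0 = MvPolynomial.eval 0 p := by
  rw [Polynomial.coeff_zero_eq_eval_zero, eval_lineRestrict, zero_smul]

/-- Product rule at the origin, where `X i` vanishes; it drives the inductive proof that the linear
part is linear in the direction. -/
theorem lineRestrict_mul_X (p : MvPolynomial σ K) (i : σ) (y : σ → K) :
    (lineRestrict (p * MvPolynomial.X i) y).coeff 1 = MvPolynomial.eval 0 p * y i := by
  rw [lineRestrict, map_mul, MvPolynomial.aeval_X, ← mul_assoc, Polynomial.coeff_mul_X,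
    Polynomial.coeff_mul_C, ← lineRestrict, coeff_zero_lineRestrict]

/-- The linear part at the origin of a polynomial. -/
noncomputable def linearPart (p : MvPolynomial σ K) : (σ → K) →ₗ[K] K where
  toFun y := (lineRestrict p y).coeff 1
  map_add' x y := by
    induction p using MvPolynomial.induction_on with
    | C a => simp [lineRestrict]
    | add p q hp hq =>
      simp only [lineRestrict, map_add, Polynomial.coeff_add] at hp hq ⊢
      rw [hp, hq]; ring
    | mul_X p i hp => simp only [lineRestrict_mul_X, Pi.add_apply]; ring
  map_smul' c x := by
    induction p using MvPolynomial.induction_on with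
    | C a => simp [lineRestrict]
    | add p q hp hq =>
      simp only [lineRestrict, map_add, Polynomial.coeff_add, RingHom.id_apply,
        smul_eq_mul] at hp hq ⊢
      rw [hp, hq]; ring
    | mul_X p i hp =>
      simp only [lineRestrict_mul_X, Pi.smul_apply, RingHom.id_apply, smul_eq_mul]; ring

theorem dvd_aeval_sub_C (p : MvPolynomial σ K) (f : σ → Polynomial K) (d : Polynomial K)
    (hd : ∀ i, d ∣ f i) :
    d ∣ MvPolynomial.aeval f p - Polynomial.C (MvPolynomial.eval 0 p) := by
  induction p using MvPolynomial.induction_on with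
  | C a => simp
  | add p q hp hq =>
    simp only [map_add]
    rw [add_sub_add_comm]
    exact dvd_add hp hq
  | mul_X p i hp => simpa using Dvd.dvd.mul_left (hd i) _

end LinearPart

/-! ### Polynomial isomorphisms of bilinear monoids are linear -/

section Linearity

variable {K : Type*} [Field K] [Infinite K] {n : ℕ}

/-- A biregular map between affine spaces which intertwines two bilinear multiplications, the
first of which is unital, is linear. -/
theorem IsPolyAut.exists_linearEquiv {e : (Fin n → K) ≃ (Fin n → K)} (he : IsPolyAut e)
    (B B' : (Fin n → K) →ₗ[K] (Fin n → K) →ₗ[K] (Fin n → K)) (u : Fin n → K)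
    (hu : ∀ x, B x u = x) (h : ∀ x y, e (B x y) = B' (e x) (e y)) :
    ∃ L : (Fin n → K) ≃ₗ[K] (Fin n → K), ∀ x, L x = e x := by
  obtain ⟨⟨p, hp⟩, q, hq⟩ := he
  have he0 : e 0 = 0 := by simpa using h (e.symm 0) 0
  set ℓ : (Fin n → K) →ₗ[K] (Fin n → K) := LinearMap.pi fun j => linearPart (p j) with hℓ
  -- Differentiate `e (B x y) = B' (e x) (e y)` in `y` at `0`: replace `y` by `c • y` and compare
  -- coefficients of `c`.
  have hmul : ∀ x y, ℓ (B x y) = B' (e x) (ℓ y) := by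
    intro x y
    funext j
    have key : lineRestrict (p j) (B x y) =
        ∑ k, lineRestrict (p k) y *
          Polynomial.C (B' (e x) (fun i => if k = i then 1 else 0) j) := by
      refine Polynomial.funext fun c => ?_
      rw [eval_lineRestrict, ← hp, ← map_smul, h, LinearMap.pi_apply_eq_sum_univ (B' (e x)),
        Polynomial.eval_finsetSum, Finset.sum_apply]
      refine Finset.sum_congr rfl fun k _ => ?_
      rw [Polynomial.eval_mul, eval_lineRestrict, ← hp, Polynomial.eval_C, Pi.smul_apply,
        smul_eq_mul]
    have hcoeff := congrArg (fun P => Polynomial.coeff P 1) key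
    simp only [Polynomial.finsetSum_coeff, Polynomial.coeff_mul_C] at hcoeff
    rw [LinearMap.pi_apply_eq_sum_univ (B' (e x)), Finset.sum_apply]
    exact hcoeff
  -- Chain rule for the inverse: if `ℓ y = 0`, then `e (c • y)` is divisible by `c²`, hence so is
  -- `e.symm (e (c • y)) = c • y`.
  have hinj : ∀ y, ℓ y = 0 → y = 0 := by
    intro y hy
    funext j
    have hd : ∀ i, (Polynomial.X : Polynomial K) ^ 2 ∣ lineRestrict (p i) y := by
      intro i
      rw [Polynomial.X_pow_dvd_iff]
      intro d hd
      interval_cases d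
      · rw [coeff_zero_lineRestrict, ← hp, he0, Pi.zero_apply]
      · exact congrFun hy i
    have h1 := dvd_aeval_sub_C (q j) (fun i => lineRestrict (p i) y) _ hd
    have h2 : MvPolynomial.aeval (fun i => lineRestrict (p i) y) (q j) =
        Polynomial.C (y j) * Polynomial.X := by
      refine Polynomial.funext fun c => ?_
      rw [eval_aeval_polynomial]
      simp only [eval_lineRestrict, ← hp, ← hq]
      rw [show (fun i => e (c • y) i) = e (c • y) from rfl, e.symm_apply_apply]
      simp only [Polynomial.eval_mul, Polynomial.eval_C, Polynomial.eval_X, Pi.smul_apply,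
        smul_eq_mul]
      exact mul_comm _ _
    have h3 : MvPolynomial.eval 0 (q j) = 0 := by
      rw [← hq, ← he0, e.symm_apply_apply, Pi.zero_apply]
    rw [h2, h3, map_zero, sub_zero, Polynomial.X_pow_dvd_iff] at h1
    simpa using h1 1 (by norm_num)
  -- With `y = u`, the injective linear map `z ↦ B' z (ℓ u)` carries `e` to the linear map `ℓ`, so
  -- `e` itself is linear.
  have hone : ∀ x, B' (e x) (ℓ u) = ℓ x := fun x => by rw [← hmul, hu]
  have hcancel : ∀ z, B' z (ℓ u) = 0 → z = 0 := by
    intro z hz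
    have := hone (e.symm z)
    rw [e.apply_symm_apply, hz] at this
    rw [← e.apply_symm_apply z, hinj _ this.symm, he0]
  refine ⟨{ e with
    map_add' := fun x y => ?_
    map_smul' := fun c x => ?_ }, fun x => rfl⟩
  · refine sub_eq_zero.1 (hcancel _ ?_)
    simp [hone]
  · refine sub_eq_zero.1 (hcancel _ ?_)
    simp [hone]

end Linearity

/-! ### Affine space as a parameter variety -/

section AffineSpace

variable {K : Type*} [Field K]

theorem isAffineVariety_univ (m : ℕ) : IsAffineVariety (Set.univ : Set (Fin m → K)) :=
  ⟨⊥, Ideal.isPrime_bot, by simp⟩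

theorem dimension_univ [Infinite K] (m : ℕ) :
    dimension (Set.univ : Set (Fin m → K)) = m := by
  have h : MvPolynomial.vanishingIdeal K (Set.univ : Set (Fin m → K)) = ⊥ := by
    refine (Submodule.eq_bot_iff _).2 fun p hp => MvPolynomial.funext fun x => ?_
    simpa [MvPolynomial.aeval_eq_eval] using MvPolynomial.mem_vanishingIdeal_iff.1 hp x trivial
  rw [dimension, h, ringKrullDim_eq_of_ringEquiv (RingEquiv.quotientBot _)]
  simp [MvPolynomial.ringKrullDim_of_isNoetherianRing]

end AffineSpace

/-! ### Invariants of binary quartics -/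

section QuarticInvariants

variable {K : Type*} [Field K] [CharZero K]

/-- The values of a binary quartic form determine its coefficients. -/
theorem binaryQuartic_coeff_eq {a b c d e a' b' c' d' e' : K}
    (h : ∀ x y : K, a * x ^ 4 + b * x ^ 3 * y + c * x ^ 2 * y ^ 2 + d * x * y ^ 3 + e * y ^ 4 =
      a' * x ^ 4 + b' * x ^ 3 * y + c' * x ^ 2 * y ^ 2 + d' * x * y ^ 3 + e' * y ^ 4) :
    a = a' ∧ b = b' ∧ c = c' ∧ d = d' ∧ e = e' := by
  have h1 := h 1 0
  have h2 := h 0 1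
  have h3 := h 1 1
  have h4 := h 1 (-1)
  have h5 := h 2 1
  refine ⟨by linear_combination h1, ?_, ?_, ?_, by linear_combination h2⟩
  · linear_combination h5 / 6 - h3 / 2 - h4 / 6 - 2 * h1 + h2 / 2
  · linear_combination h3 / 2 + h4 / 2 - h1 - h2
  · linear_combination -h5 / 6 + h3 - h4 / 3 + 2 * h1 - h2 / 2

/-- The invariants of degrees two and three of a binary quartic separate the quartics
`y (x³ + t x y² + t y³)` up to linear substitutions and scaling. -/
theorem binaryQuartic_eq_of_equiv {s t : K} (hs : s ≠ 0) {p q r w g : K}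
    (hdet : p * w - q * r ≠ 0)
    (h : ∀ x y : K,
      (q * x + w * y) * ((p * x + r * y) ^ 3 + s * (p * x + r * y) * (q * x + w * y) ^ 2
        + s * (q * x + w * y) ^ 3) = g ^ 2 * (y * (x ^ 3 + t * x * y ^ 2 + t * y ^ 3))) :
    s = t := by
  obtain ⟨ha, hb, hc, hd, he⟩ := binaryQuartic_coeff_eq
    (a := q * p ^ 3 + s * p * q ^ 3 + s * q ^ 4)
    (b := w * p ^ 3 + 3 * q * p ^ 2 * r + s * (r * q ^ 3 + 3 * p * q ^ 2 * w) + 4 * s * q ^ 3 * w)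
    (c := 3 * w * p ^ 2 * r + 3 * q * p * r ^ 2 + s * (3 * r * q ^ 2 * w + 3 * p * q * w ^ 2)
      + 6 * s * q ^ 2 * w ^ 2)
    (d := 3 * w * p * r ^ 2 + q * r ^ 3 + s * (3 * r * q * w ^ 2 + p * w ^ 3)
      + 4 * s * q * w ^ 3)
    (e := w * r ^ 3 + s * r * w ^ 3 + s * w ^ 4)
    (a' := 0) (b' := g ^ 2) (c' := 0) (d' := g ^ 2 * t) (e' := g ^ 2 * t)
    (fun x y => by linear_combination h x y)
  -- The invariant `I = 12ae - 3bd + c²` has degree 2 and weight 4.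
  have hI : (p * w - q * r) ^ 4 * s = g ^ 4 * t := by
    have : -3 * ((p * w - q * r) ^ 4 * s) =
        12 * (q * p ^ 3 + s * p * q ^ 3 + s * q ^ 4) * (w * r ^ 3 + s * r * w ^ 3 + s * w ^ 4)
        - 3 * (w * p ^ 3 + 3 * q * p ^ 2 * r + s * (r * q ^ 3 + 3 * p * q ^ 2 * w)
            + 4 * s * q ^ 3 * w) *
          (3 * w * p * r ^ 2 + q * r ^ 3 + s * (3 * r * q * w ^ 2 + p * w ^ 3)
            + 4 * s * q * w ^ 3)
        + (3 * w * p ^ 2 * r + 3 * q * p * r ^ 2 + s * (3 * r * q ^ 2 * w + 3 * p * q * w ^ 2)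
            + 6 * s * q ^ 2 * w ^ 2) ^ 2 := by ring
    rw [ha, hb, hc, hd, he] at this
    linear_combination -this / 3
  -- The invariant `J = 72ace + 9bcd - 27ad² - 27eb² - 2c³` has degree 3 and weight 6.
  have hJ : (p * w - q * r) ^ 6 * s = g ^ 6 * t := by
    have : -27 * ((p * w - q * r) ^ 6 * s) =
        72 * (q * p ^ 3 + s * p * q ^ 3 + s * q ^ 4)
          * (3 * w * p ^ 2 * r + 3 * q * p * r ^ 2
            + s * (3 * r * q ^ 2 * w + 3 * p * q * w ^ 2) + 6 * s * q ^ 2 * w ^ 2)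
          * (w * r ^ 3 + s * r * w ^ 3 + s * w ^ 4)
        + 9 * (w * p ^ 3 + 3 * q * p ^ 2 * r + s * (r * q ^ 3 + 3 * p * q ^ 2 * w)
            + 4 * s * q ^ 3 * w)
          * (3 * w * p ^ 2 * r + 3 * q * p * r ^ 2
            + s * (3 * r * q ^ 2 * w + 3 * p * q * w ^ 2) + 6 * s * q ^ 2 * w ^ 2)
          * (3 * w * p * r ^ 2 + q * r ^ 3 + s * (3 * r * q * w ^ 2 + p * w ^ 3)
            + 4 * s * q * w ^ 3)
        - 27 * (q * p ^ 3 + s * p * q ^ 3 + s * q ^ 4)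
          * (3 * w * p * r ^ 2 + q * r ^ 3 + s * (3 * r * q * w ^ 2 + p * w ^ 3)
            + 4 * s * q * w ^ 3) ^ 2
        - 27 * (w * r ^ 3 + s * r * w ^ 3 + s * w ^ 4)
          * (w * p ^ 3 + 3 * q * p ^ 2 * r + s * (r * q ^ 3 + 3 * p * q ^ 2 * w)
            + 4 * s * q ^ 3 * w) ^ 2
        - 2 * (3 * w * p ^ 2 * r + 3 * q * p * r ^ 2
            + s * (3 * r * q ^ 2 * w + 3 * p * q * w ^ 2) + 6 * s * q ^ 2 * w ^ 2) ^ 3 := by ring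
    rw [ha, hb, hc, hd, he] at this
    linear_combination -this / 27
  set D := p * w - q * r
  have hD : D ^ 4 * s ≠ 0 := mul_ne_zero (pow_ne_zero _ hdet) hs
  have hsq : D ^ 2 = g ^ 2 := by
    refine mul_left_cancel₀ hD ?_
    linear_combination hJ - g ^ 2 * hI
  refine mul_left_cancel₀ (pow_ne_zero 4 hdet) ?_
  linear_combination hI - t * (D ^ 2 + g ^ 2) * hsq

end QuarticInvariants

/-! ### The local algebra of a pencil of quadrics -/

section PencilAlgebra

variable {K : Type u} [Field K] {n : ℕ} (hn : 7 ≤ n)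

/-- The first of the two quadratic forms of the pencil, in polarized form. -/
def pencilForm₁ (x y : Fin n → K) : K :=
  x (Fin.castLE hn 2) * y (Fin.castLE hn 4) + x (Fin.castLE hn 4) * y (Fin.castLE hn 2)
    + x (Fin.castLE hn 3) * y (Fin.castLE hn 3)

/-- The second of the two quadratic forms of the pencil, in polarized form. -/
def pencilForm₂ (t : K) (x y : Fin n → K) : K :=
  x (Fin.castLE hn 1) * y (Fin.castLE hn 1) + t * (x (Fin.castLE hn 2) * y (Fin.castLE hn 2))
    + x (Fin.castLE hn 3) * y (Fin.castLE hn 4) + x (Fin.castLE hn 4) * y (Fin.castLE hn 3)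
    - x (Fin.castLE hn 4) * y (Fin.castLE hn 4)

/-- The multiplication on `K ^ n` with unit `e₀` for which the product of two elements of the span
of the other basis vectors is given by a pencil of quaternary quadratic forms in the coordinates
`1, …, 4`, with values in the span of `e₅` and `e₆`. -/
def pencilMul (t : K) (x y : Fin n → K) : Fin n → K :=
  x (Fin.castLE hn 0) • y + y (Fin.castLE hn 0) • x
    - (x (Fin.castLE hn 0) * y (Fin.castLE hn 0)) • Pi.single (Fin.castLE hn 0) 1
    + pencilForm₁ hn x y • Pi.single (Fin.castLE hn 5) 1
    + pencilForm₂ hn t x y • Pi.single (Fin.castLE hn 6) 1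

theorem pencilMul_apply (t : K) (x y : Fin n → K) (i : Fin n) :
    pencilMul hn t x y i = x (Fin.castLE hn 0) * y i + y (Fin.castLE hn 0) * x i
      - x (Fin.castLE hn 0) * y (Fin.castLE hn 0) * Pi.single (M := fun _ => K)
        (Fin.castLE hn 0) 1 i
      + pencilForm₁ hn x y * Pi.single (M := fun _ => K) (Fin.castLE hn 5) 1 i
      + pencilForm₂ hn t x y * Pi.single (M := fun _ => K) (Fin.castLE hn 6) 1 i := rfl

/-- Coordinate `0` is the residue map to `K`; the subtracted term of the product removes the double
count of `x₀ y₀`. -/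
theorem pencilMul_apply_zero (t : K) (x y : Fin n → K) :
    pencilMul hn t x y (Fin.castLE hn 0) = x (Fin.castLE hn 0) * y (Fin.castLE hn 0) := by
  simp [pencilMul_apply, mul_comm (y _)]

theorem pencilMul_apply_of_mem {i : Fin 7} (h0 : i ≠ 0) (h5 : i ≠ 5) (h6 : i ≠ 6) (t : K)
    (x y : Fin n → K) :
    pencilMul hn t x y (Fin.castLE hn i) =
      x (Fin.castLE hn 0) * y (Fin.castLE hn i) + y (Fin.castLE hn 0) * x (Fin.castLE hn i) := by
  simp [pencilMul_apply, h0, h5, h6]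

theorem pencilMul_comm (t : K) (x y : Fin n → K) :
    pencilMul hn t x y = pencilMul hn t y x := by
  funext i
  simp only [pencilMul_apply, pencilForm₁, pencilForm₂]
  ring

/-- The forms see only coordinates `1, …, 4`, which vanish on products of elements of `𝔪`, so triple
products in `𝔪` are zero. -/
theorem pencilMul_assoc (t : K) (x y z : Fin n → K) :
    pencilMul hn t (pencilMul hn t x y) z = pencilMul hn t x (pencilMul hn t y z) := by
  have h1 := @pencilMul_apply_of_mem K _ n hn 1 (by decide) (by decide) (by decide)
  have h2 := @pencilMul_apply_of_mem K _ n hn 2 (by decide) (by decide) (by decide)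
  have h3 := @pencilMul_apply_of_mem K _ n hn 3 (by decide) (by decide) (by decide)
  have h4 := @pencilMul_apply_of_mem K _ n hn 4 (by decide) (by decide) (by decide)
  funext i
  rw [pencilMul_apply, pencilMul_apply hn t x (pencilMul hn t y z) i]
  simp only [pencilForm₁, pencilForm₂, h1, h2, h3, h4, pencilMul_apply_zero]
  rw [pencilMul_apply hn t x y, pencilMul_apply hn t y z]
  simp only [pencilForm₁, pencilForm₂]
  ring

theorem one_pencilMul (t : K) (x : Fin n → K) :
    pencilMul hn t (Pi.single (Fin.castLE hn 0) 1) x = x := by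
  funext i
  simp [pencilMul_apply, pencilForm₁, pencilForm₂]

theorem pencilMul_of_apply_zero (t : K) {x y : Fin n → K} (hx : x (Fin.castLE hn 0) = 0)
    (hy : y (Fin.castLE hn 0) = 0) :
    pencilMul hn t x y = pencilForm₁ hn x y • Pi.single (Fin.castLE hn 5) 1
      + pencilForm₂ hn t x y • Pi.single (Fin.castLE hn 6) 1 := by
  simp [pencilMul, hx, hy]

theorem pencilMul_pencilMul_self (t : K) {x : Fin n → K} (hx : x (Fin.castLE hn 0) = 0) :
    pencilMul hn t (pencilMul hn t x x) x = 0 := by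
  rw [pencilMul_of_apply_zero hn t hx hx, pencilMul_of_apply_zero hn t _ hx]
  all_goals simp [pencilForm₁, pencilForm₂]

/-- `pencilMul` as a bilinear map. -/
def pencilBilin (t : K) : (Fin n → K) →ₗ[K] (Fin n → K) →ₗ[K] (Fin n → K) :=
  LinearMap.mk₂ K (pencilMul hn t)
    (fun x y z => by
      funext i; simp only [pencilMul_apply, pencilForm₁, pencilForm₂, Pi.add_apply]; ring)
    (fun c x y => by
      funext i
      simp only [pencilMul_apply, pencilForm₁, pencilForm₂, Pi.smul_apply, smul_eq_mul]; ring)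
    (fun x y z => by
      funext i; simp only [pencilMul_apply, pencilForm₁, pencilForm₂, Pi.add_apply]; ring)
    (fun c x y => by
      funext i
      simp only [pencilMul_apply, pencilForm₁, pencilForm₂, Pi.smul_apply, smul_eq_mul]; ring)

/-- The space `K ^ n` with the multiplication `pencilMul`. -/
@[nolint unusedArguments]
def PencilAlgebra (_ : 7 ≤ n) (_ : K) : Type u := Fin n → K

namespace PencilAlgebra

variable (t : K)

instance : AddCommGroup (PencilAlgebra hn t) := inferInstanceAs (AddCommGroup (Fin n → K))

instance : Module K (PencilAlgebra hn t) := inferInstanceAs (Module K (Fin n → K))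

instance : CommRing (PencilAlgebra hn t) :=
  { (inferInstance : AddCommGroup (PencilAlgebra hn t)) with
    mul := pencilMul hn t
    one := (Pi.single (Fin.castLE hn 0) 1 : Fin n → K)
    mul_assoc := pencilMul_assoc hn t
    mul_comm := pencilMul_comm hn t
    one_mul := one_pencilMul hn t
    mul_one := fun x => (pencilMul_comm hn t _ _).trans (one_pencilMul hn t x)
    left_distrib := fun x y z => (pencilBilin hn t x).map_add y z
    right_distrib := fun x y z => (pencilBilin hn t).map_add₂ x y z
    zero_mul := fun x => (pencilBilin hn t).map_zero₂ x
    mul_zero := fun x => (pencilBilin hn t x).map_zero }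

instance : Algebra K (PencilAlgebra hn t) :=
  Algebra.ofModule (fun c x y => (pencilBilin hn t).map_smul₂ c x y)
    (fun c x y => (pencilBilin hn t x).map_smul c y)

/-- The standard basis of `K ^ n`. -/
noncomputable def basis : Module.Basis (Fin n) K (PencilAlgebra hn t) :=
  Module.Basis.ofEquivFun (LinearEquiv.refl K (Fin n → K))

theorem pow_three_eq_zero {x : PencilAlgebra hn t}
    (hx : (show Fin n → K from x) (Fin.castLE hn 0) = 0) : x ^ 3 = 0 := by
  rw [pow_three']
  exact pencilMul_pencilMul_self hn t hx

/-- Such an element is a nonzero scalar plus a nilpotent. -/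
theorem isUnit_of_apply_zero_ne_zero {x : PencilAlgebra hn t}
    (hx : (show Fin n → K from x) (Fin.castLE hn 0) ≠ 0) : IsUnit x := by
  set a : K := (show Fin n → K from x) (Fin.castLE hn 0) with ha
  have hnil : IsNilpotent (x - a • (1 : PencilAlgebra hn t)) := by
    refine ⟨3, pow_three_eq_zero hn t ?_⟩
    change a - a * (Pi.single (Fin.castLE hn 0) 1 : Fin n → K) (Fin.castLE hn 0) = 0
    rw [Pi.single_eq_same, mul_one, sub_self]
  have hu : IsUnit (a • (1 : PencilAlgebra hn t)) := by
    rw [← Algebra.algebraMap_eq_smul_one]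
    exact (IsUnit.mk0 a hx).map _
  rw [← add_sub_cancel (a • (1 : PencilAlgebra hn t)) x]
  exact hnil.isUnit_add_left_of_commute hu (Commute.all _ _)

instance : IsLocalRing (PencilAlgebra hn t) := by
  have : Nontrivial (PencilAlgebra hn t) :=
    haveI : Nonempty (Fin n) := ⟨Fin.castLE hn 0⟩
    inferInstanceAs (Nontrivial (Fin n → K))
  refine IsLocalRing.of_isUnit_or_isUnit_one_sub_self fun x => ?_
  by_cases hx : (show Fin n → K from x) (Fin.castLE hn 0) = 0
  · refine Or.inr (isUnit_of_apply_zero_ne_zero hn t ?_)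
    change (Pi.single (Fin.castLE hn 0) 1 : Fin n → K) (Fin.castLE hn 0)
      - (show Fin n → K from x) (Fin.castLE hn 0) ≠ 0
    rw [hx, Pi.single_eq_same, sub_zero]
    exact one_ne_zero
  · exact Or.inl (isUnit_of_apply_zero_ne_zero hn t hx)

end PencilAlgebra

/-- The multiplicative monoid of `PencilAlgebra hn t`. -/
noncomputable def pencilMonoid (t : K) : AlgMonoid K n :=
  AlgMonoid.ofAlgebra (PencilAlgebra.basis hn t)

theorem pencilMonoid_mul (t : K) (x y : Fin n → K) :
    (pencilMonoid hn t).mul x y = pencilMul hn t x y := by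
  simp only [pencilMonoid, AlgMonoid.ofAlgebra, PencilAlgebra.basis]
  rfl

theorem pencilMonoid_one (t : K) :
    (pencilMonoid hn t).one = Pi.single (Fin.castLE hn 0) 1 := by
  simp only [pencilMonoid, AlgMonoid.ofAlgebra, PencilAlgebra.basis]
  rfl

theorem isPolyAut_refl : IsPolyAut (Equiv.refl (Fin n → K)) :=
  ⟨⟨MvPolynomial.X, by simp⟩, ⟨MvPolynomial.X, by simp⟩⟩

theorem pencilMonoid_isCommutative (t : K) : (pencilMonoid hn t).IsCommutative := fun x y => by
  rw [pencilMonoid_mul, pencilMonoid_mul, pencilMul_comm]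

theorem pencilMonoid_isBilinear (t : K) : (pencilMonoid hn t).IsBilinear :=
  ⟨Equiv.refl _, isPolyAut_refl, pencilBilin hn t, fun x y => pencilMonoid_mul hn t x y⟩

theorem pencilMonoid_isOfLocalAlgebra (t : K) : (pencilMonoid hn t).IsOfLocalAlgebra :=
  ⟨PencilAlgebra hn t, inferInstance, inferInstance, PencilAlgebra.basis hn t, inferInstance,
    Equiv.refl _, isPolyAut_refl, rfl, fun _ _ => rfl⟩

theorem isAlgebraicFamily_pencilMonoid :
    IsAlgebraicFamily fun t : (Set.univ : Set (Fin 1 → K)) => pencilMonoid hn (t.1 0) := by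
  let T : MvPolynomial (Fin 1 ⊕ (Fin n ⊕ Fin n)) K := MvPolynomial.X (Sum.inl 0)
  let X : Fin n → MvPolynomial (Fin 1 ⊕ (Fin n ⊕ Fin n)) K :=
    fun i => MvPolynomial.X (Sum.inr (Sum.inl i))
  let Y : Fin n → MvPolynomial (Fin 1 ⊕ (Fin n ⊕ Fin n)) K :=
    fun i => MvPolynomial.X (Sum.inr (Sum.inr i))
  let c : Fin 7 → Fin n := Fin.castLE hn
  refine ⟨⟨fun i => X (c 0) * Y i + Y (c 0) * X i
      - X (c 0) * Y (c 0) * MvPolynomial.C (Pi.single (M := fun _ => K) (c 0) 1 i)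
      + (X (c 2) * Y (c 4) + X (c 4) * Y (c 2) + X (c 3) * Y (c 3))
        * MvPolynomial.C (Pi.single (M := fun _ => K) (c 5) 1 i)
      + (X (c 1) * Y (c 1) + T * (X (c 2) * Y (c 2)) + X (c 3) * Y (c 4) + X (c 4) * Y (c 3)
        - X (c 4) * Y (c 4)) * MvPolynomial.C (Pi.single (M := fun _ => K) (c 6) 1 i),
      fun t x y i => ?_⟩,
    fun i => MvPolynomial.C (Pi.single (M := fun _ => K) (c 0) 1 i), fun t i => ?_⟩
  · rw [pencilMonoid_mul, pencilMul_apply]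
    simp only [pencilForm₁, pencilForm₂, map_add, map_sub, map_mul, MvPolynomial.eval_X,
      MvPolynomial.eval_C, Sum.elim_inl, Sum.elim_inr, c, X, Y, T]
  · rw [pencilMonoid_one, MvPolynomial.eval_C]

end PencilAlgebra

/-! ### Recovering the parameter from the algebra -/

section Classification

variable {K : Type u} [Field K] {n : ℕ} (hn : 7 ≤ n)

/-- The Gram matrix of a member of the pencil in the coordinates `1, …, 4`. -/
def pencilMatrix (t a b : K) : Matrix (Fin 4) (Fin 4) K :=
  !![b, 0, 0, 0; 0, t * b, 0, a; 0, 0, a, b; 0, a, b, -b]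

theorem det_pencilMatrix (t a b : K) :
    (pencilMatrix t a b).det = -(b * (a ^ 3 + t * a * b ^ 2 + t * b ^ 3)) := by
  simp [pencilMatrix, Matrix.det_succ_row_zero, Fin.sum_univ_succ, Fin.succAbove]
  ring

theorem transpose_mul_pencilMatrix_mul (t a b : K) (u : Fin 4 → Fin n → K) :
    (Matrix.of fun k i => u i (Fin.castLE hn k.succ.castSucc.castSucc)).transpose *
      pencilMatrix t a b * (Matrix.of fun k i => u i (Fin.castLE hn k.succ.castSucc.castSucc)) =
    Matrix.of fun i j =>
      a * pencilForm₁ hn (u i) (u j) + b * pencilForm₂ hn t (u i) (u j) := by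
  ext i j
  simp only [Matrix.mul_apply, pencilMatrix, Fin.sum_univ_four, Matrix.of_apply, pencilForm₁,
    pencilForm₂, Matrix.transpose_apply]
  simp
  ring

theorem eq_of_pencilMul_linearEquiv [CharZero K] {s t : K} (hs : s ≠ 0)
    (L : (Fin n → K) ≃ₗ[K] (Fin n → K))
    (hL : ∀ x y, L (pencilMul hn s x y) = pencilMul hn t (L x) (L y)) : s = t := by
  -- Cubes vanish on `𝔪`, and coordinate `0` is multiplicative, so `L` preserves `𝔪`.
  have hnil : ∀ {x : Fin n → K}, x (Fin.castLE hn 0) = 0 → L x (Fin.castLE hn 0) = 0 := by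
    intro x hx
    have h := congrArg L (pencilMul_pencilMul_self hn s hx)
    rw [hL, hL, map_zero] at h
    have h0 := congrFun h (Fin.castLE hn 0)
    simpa [pencilMul_apply_zero] using h0
  set E : Fin 7 → Fin n → K := fun i => Pi.single (Fin.castLE hn i) 1 with hE
  have hEij : ∀ i j, E i (Fin.castLE hn j) = if j = i then 1 else 0 := fun i j => by
    simp only [hE, Pi.single_apply, Fin.castLE_inj]
  have hmul : ∀ {x y : Fin n → K}, x (Fin.castLE hn 0) = 0 → y (Fin.castLE hn 0) = 0 →
      pencilForm₁ hn x y • L (E 5) + pencilForm₂ hn s x y • L (E 6) =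
        pencilForm₁ hn (L x) (L y) • E 5 + pencilForm₂ hn t (L x) (L y) • E 6 := by
    intro x y hx hy
    rw [← pencilMul_of_apply_zero hn t (hnil hx) (hnil hy), ← hL,
      pencilMul_of_apply_zero hn s hx hy, map_add, map_smul, map_smul]
  set p := L (E 5) (Fin.castLE hn 5)
  set r := L (E 5) (Fin.castLE hn 6)
  set q := L (E 6) (Fin.castLE hn 5)
  set w := L (E 6) (Fin.castLE hn 6)
  have hform₁ : ∀ {x y : Fin n → K}, x (Fin.castLE hn 0) = 0 → y (Fin.castLE hn 0) = 0 →
      pencilForm₁ hn (L x) (L y) = pencilForm₁ hn x y * p + pencilForm₂ hn s x y * q := by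
    intro x y hx hy
    have h := congrFun (hmul hx hy) (Fin.castLE hn 5)
    simpa [hEij] using h.symm
  have hform₂ : ∀ {x y : Fin n → K}, x (Fin.castLE hn 0) = 0 → y (Fin.castLE hn 0) = 0 →
      pencilForm₂ hn t (L x) (L y) = pencilForm₁ hn x y * r + pencilForm₂ hn s x y * w := by
    intro x y hx hy
    have h := congrFun (hmul hx hy) (Fin.castLE hn 6)
    simpa [hEij] using h.symm
  -- `E 5` is the product of `E 2` and `E 4`, and `E 6` is the square of `E 1`, so `L` maps the
  -- plane `𝔪²` into itself.
  have hL5 : L (E 5) = p • E 5 + r • E 6 := by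
    have hx : E 2 (Fin.castLE hn 0) = 0 := by simp [hEij]
    have hy : E 4 (Fin.castLE hn 0) = 0 := by simp [hEij]
    have h := hmul hx hy
    rw [hform₁ hx hy, hform₂ hx hy] at h
    simpa [pencilForm₁, pencilForm₂, hEij] using h
  have hL6 : L (E 6) = q • E 5 + w • E 6 := by
    have hx : E 1 (Fin.castLE hn 0) = 0 := by simp [hEij]
    have h := hmul hx hx
    rw [hform₁ hx hx, hform₂ hx hx] at h
    simpa [pencilForm₁, pencilForm₂, hEij] using h
  have hdet : p * w - q * r ≠ 0 := by
    intro h0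
    have hker : ∀ a b : K, a * p + b * q = 0 → a * r + b * w = 0 → a = 0 ∧ b = 0 := by
      intro a b h1 h2
      have h : L (a • E 5 + b • E 6) = 0 := by
        rw [map_add, map_smul, map_smul, hL5, hL6, show a • (p • E 5 + r • E 6)
          + b • (q • E 5 + w • E 6) = (a * p + b * q) • E 5 + (a * r + b * w) • E 6 by module,
          h1, h2, zero_smul, zero_smul, add_zero]
      rw [map_eq_zero_iff L L.injective] at h
      have h5 := congrFun h (Fin.castLE hn 5)
      have h6 := congrFun h (Fin.castLE hn 6)
      simp [hEij] at h5 h6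
      exact ⟨h5, h6⟩
    obtain ⟨hw, hr⟩ := hker w (-r) (by linear_combination h0) (by ring)
    obtain ⟨hq, hp⟩ := hker q (-p) (by ring) (by linear_combination -h0)
    exact one_ne_zero (hker 1 0 (by linear_combination -hp) (by linear_combination -hr)).1
  -- Here `g` is the determinant of the block of `L` on coordinates `1, …, 4`; congruence of Gram
  -- matrices multiplies the discriminant by `g²`.
  refine binaryQuartic_eq_of_equiv hs hdet
    (g := (Matrix.of fun k i => L (E i.succ.castSucc.castSucc)
      (Fin.castLE hn k.succ.castSucc.castSucc) : Matrix (Fin 4) (Fin 4) K).det) fun a b => ?_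
  have hG := transpose_mul_pencilMatrix_mul hn t a b fun i => L (E i.succ.castSucc.castSucc)
  have hS : (Matrix.of fun i j : Fin 4 =>
      a * pencilForm₁ hn (L (E i.succ.castSucc.castSucc)) (L (E j.succ.castSucc.castSucc))
      + b * pencilForm₂ hn t (L (E i.succ.castSucc.castSucc)) (L (E j.succ.castSucc.castSucc))) =
      pencilMatrix s (p * a + r * b) (q * a + w * b) := by
    ext i j
    have h0 : ∀ i : Fin 4, E i.succ.castSucc.castSucc (Fin.castLE hn 0) = 0 := fun i => by
      rw [hEij, if_neg]
      revert i
      decide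
    rw [Matrix.of_apply, hform₁ (h0 i) (h0 j), hform₂ (h0 i) (h0 j)]
    simp only [pencilForm₁, pencilForm₂, hEij, pencilMatrix]
    fin_cases i <;> fin_cases j <;> simp [Fin.ext_iff] <;> ring
  rw [hS] at hG
  have hd := congrArg Matrix.det hG
  rw [Matrix.det_mul, Matrix.det_mul, Matrix.det_transpose, det_pencilMatrix,
    det_pencilMatrix] at hd
  linear_combination hd

theorem eq_of_pencilMonoid_isomorphic [CharZero K] {s t : K}
    (h : (pencilMonoid hn s).Isomorphic (pencilMonoid hn t)) : s = t := by
  obtain ⟨e, he, -, hmul⟩ := h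
  simp only [pencilMonoid_mul] at hmul
  obtain ⟨L, hL⟩ := he.exists_linearEquiv (pencilBilin hn s) (pencilBilin hn t)
    (Pi.single (Fin.castLE hn 0) 1)
    (fun x => (pencilMul_comm hn s _ _).trans (one_pencilMul hn s x)) hmul
  have hL' : ∀ x y, L (pencilMul hn s x y) = pencilMul hn t (L x) (L y) := fun x y => by
    rw [hL, hL, hL, hmul]
  -- The invariants need a nonzero source parameter; when `s = 0 ≠ t`, use the inverse map.
  by_cases hs : s = 0
  · by_cases ht : t = 0
    · rw [hs, ht]
    · refine (eq_of_pencilMul_linearEquiv hn ht L.symm fun x y => ?_).symm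
      rw [L.symm_apply_eq, hL', L.apply_symm_apply, L.apply_symm_apply]
  · exact eq_of_pencilMul_linearEquiv hn hs L hL'

end Classification
end AffineMonoids

theorem proposition4p3 (K : Type*) [Field K] [IsAlgClosed K] [CharZero K]
    (n : ℕ) (hn : 7 ≤ n) :
    ∃ (m : ℕ) (M : Set (Fin m → K)) (S : M → AffineMonoids.AlgMonoid K n),
      AffineMonoids.IsAffineVariety M ∧ 0 < AffineMonoids.dimension M ∧
      AffineMonoids.IsAlgebraicFamily S ∧
      (∀ t : M, (S t).IsCommutative ∧ (S t).IsBilinear ∧ (S t).IsOfLocalAlgebra) ∧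
      (∀ s t : M, s ≠ t → ¬ (S s).Isomorphic (S t)) := by
  refine ⟨1, Set.univ, fun t => AffineMonoids.pencilMonoid hn (t.1 0),
    AffineMonoids.isAffineVariety_univ 1, ?_, AffineMonoids.isAlgebraicFamily_pencilMonoid hn,
    fun t => ⟨AffineMonoids.pencilMonoid_isCommutative hn _,
      AffineMonoids.pencilMonoid_isBilinear hn _, AffineMonoids.pencilMonoid_isOfLocalAlgebra hn _⟩,
    fun s t hst h => hst (Subtype.ext (funext fun i => ?_))⟩
  · rw [AffineMonoids.dimension_univ]
    norm_num
  · rw [Subsingleton.elim i 0]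
    exact AffineMonoids.eq_of_pencilMonoid_isomorphic hn h
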